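/- All rings are commutative with $1$. Let $R$ be a ring and $S\subseteq R$ a multiplicative subset ($1\in S$ and $S$ is closed under products). An $R$-module $T$ is *uniformly $S$-torsion* if $sT=0$ for some $s\in S$. A sequence $M\xrightarrow{f}N\xrightarrow{g}L$ of $R$-modules is *$S$-exact* (at $N$) if there is $s\in S$ with $s\operatorname{Ker}(g)\subseteq\operatorname{Im}(f)$ and $s\operatorname{Im}(f)\subseteq\operatorname{Ker}(g)$; a longer sequence is $S$-exact if it is so at each inner term. An $R$-module $F$ is *$S$-flat* if for every $S$-exact sequence $0\to A\to B\to C\to 0$ the induced sequence $0\to A\otimes_RF\to B\otimes_RF\to C\otimes_RF\to 0$ is $S$-exact. The *$S$-flat dimension* $S\text{-}fd_R(M)$ of an $R$-module $M$ is the least $n\ge 0$ such that there is an $S$-exact sequence $0\to F_n\to\cdots\to F_1\to F_0\to M\to 0$ with all $F_i$ $S$-flat, and $\infty$ if there is no such $n$. The *$S$-weak global dimension* is $S\text{-w.gl.dim}(R)=\sup\{S\text{-}fd_R(M)\mid M\text{ an }R\text{-module}\}$. **Proposition.** Let $R$ be a ring, $S$ a multiplicative subset of $R$, and let $a\in R$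 be neither a zero-divisor nor a unit. Write $\overline R=R/aR$ and $\overline S=\{s+aR\mid s\in S\}\subseteq\overline R$. 1. Let $M$ be an $\overline R$-module that is not uniformly $\overline S$-torsion (in particular $M\neq 0$). If $\overline S\text{-}fd_{\overline R}(M)<\infty$, then $$S\text{-}fd_R(M)=\overline S\text{-}fd_{\overline R}(M)+1 .$$ 2. Suppose $0\notin\overline S$, that is, $S\cap aR=\emptyset$. If $\overline S\text{-w.gl.dim}(\overline R)<\infty$, then $$S\text{-w.gl.dim}(R)\ \ge\ \overline S\text{-w.gl.dim}(\overline R)+1 .$$ -/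

import Mathlib

open scoped TensorProduct

universe u

/-- `T` is uniformly `S`-torsion: a single element of `S` annihilates `T`. -/
def IsUniformlySTorsion {R : Type u} [CommRing R] (S : Submonoid R)
    (T : Type u) [AddCommGroup T] [Module R T] : Prop :=
  ∃ s ∈ S, ∀ t : T, s • t = 0

/-- `M --f--> N --g--> L` is `S`-exact at `N`: for some `s ∈ S`,
`s Ker g ⊆ Im f` and `s Im f ⊆ Ker g`. -/
def SExact {R : Type u} [CommRing R] (S : Submonoid R)
    {M N L : Type u} [AddCommGroup M] [AddCommGroup N] [AddCommGroup L]
    [Module R M] [Module R N] [Module R L] (f : M →ₗ[R] N) (g : N →ₗ[R] L) : Prop :=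
  ∃ s ∈ S, (∀ y ∈ LinearMap.ker g, s • y ∈ LinearMap.range f) ∧
    (∀ y ∈ LinearMap.range f, s • y ∈ LinearMap.ker g)

/-- `0 → A --f--> B --g--> C → 0` is `S`-exact, i.e. `S`-exact at each of `A`, `B` and `C`. -/
structure ShortSExact {R : Type u} [CommRing R] (S : Submonoid R)
    {A B C : Type u} [AddCommGroup A] [AddCommGroup B] [AddCommGroup C]
    [Module R A] [Module R B] [Module R C] (f : A →ₗ[R] B) (g : B →ₗ[R] C) : Prop where
  left : SExact S (0 : PUnit.{u+1} →ₗ[R] A) f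
  middle : SExact S f g
  right : SExact S g (0 : C →ₗ[R] PUnit.{u+1})

/-- `F` is `S`-flat: `- ⊗ F` preserves short `S`-exact sequences. -/
def IsSFlat {R : Type u} [CommRing R] (S : Submonoid R)
    (F : Type u) [AddCommGroup F] [Module R F] : Prop :=
  ∀ (A B C : Type u) [AddCommGroup A] [AddCommGroup B] [AddCommGroup C]
    [Module R A] [Module R B] [Module R C] (f : A →ₗ[R] B) (g : B →ₗ[R] C),
    ShortSExact S f g → ShortSExact S (f.rTensor F) (g.rTensor F)

/-- An `S`-flat `S`-resolution `0 → F_n → ⋯ → F_1 → F_0 → M → 0` of length `n`: an `S`-exact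
sequence with each `F_i` `S`-flat. The sequence is indexed by all of `ℕ`, with `F_i = 0` for
`i > n`, so that exactness at `F_n` says that `0 → F_n → F_{n-1}` is `S`-exact
(with `F_{-1} = M`). -/
structure SFlatSResolution {R : Type u} [CommRing R] (S : Submonoid R)
    (M : Type u) [AddCommGroup M] [Module R M] (n : ℕ) where
  F : ℕ → ModuleCat.{u} R
  d : ∀ i : ℕ, F (i + 1) →ₗ[R] F i
  ε : F 0 →ₗ[R] M
  flat : ∀ i ≤ n, IsSFlat S (F i)
  zero : ∀ i > n, Subsingleton (F i)
  exact_M : SExact S ε (0 : M →ₗ[R] PUnit.{u+1})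
  exact_zero : SExact S (d 0) ε
  exact_succ : ∀ i : ℕ, SExact S (d (i + 1)) (d i)

/-- The `S`-flat dimension of `M`: the length of a shortest `S`-flat `S`-resolution of `M`,
and `⊤` if there is none of finite length. -/
noncomputable def sFlatDim {R : Type u} [CommRing R] (S : Submonoid R)
    (M : Type u) [AddCommGroup M] [Module R M] : ℕ∞ :=
  sInf {k : ℕ∞ | ∃ n : ℕ, k = (n : ℕ∞) ∧ Nonempty (SFlatSResolution S M n)}

/-- The `S`-weak global dimension of `R`: the supremum of the `S`-flat dimensions of all
`R`-modules. -/
noncomputable def sWeakGlobalDim (R : Type u) [CommRing R] (S : Submonoid R) : ℕ∞ :=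
  ⨆ M : ModuleCat.{u} R, sFlatDim S M

/-! Write M⋆ for the character module of M. Modules killed by a single element of S form a Serre
class, so long exact sequences can be read up to uniform S-torsion. By tensor-hom adjunction, M is
S-flat iff every Ext¹(N, M⋆) is uniformly S-torsion; dimension shifting then gives
`sFlatDim_le_iff`, which replaces resolutions by the torsion of Ext^{n+1}(N, M⋆), with s allowed to
depend on N.

The second ingredient is change of rings, `IsRegularReduction.extTorsion_iff`, from (R, K) to (R/a,
K/aK). Syzygies over R are a-regular, so passing from R/a to R raises the dimension by at most one
(`TorTorsionAbove.of_quotient`). Conversely, an R/a-module Y embeds in K/aK, where K is its first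
syzygy over R; hence dimension n ≥ 1 over R/a cannot stay ≤ n over R (`TorTorsionAbove.quotient`).
For n = 0, multiplication by a is injective on R but zero on M, so S-flatness over R would make M
torsion. Part 2 applies part 1 to a module attaining the supremum. -/

section Ext

open CategoryTheory Abelian

/-! ### Ext groups up to uniform S-torsion -/

section Torsion

variable {R : Type u} [CommRing R] {S : Submonoid R}

/-- Multiplying by t moves v into the image of f, where s kills. All long exact sequence arguments
rest on this. -/
lemma isUniformlySTorsion_of_exact {U V W : Type u} [AddCommGroup U] [AddCommGroup V]
    [AddCommGroup W] [Module R U] [Module R V] [Module R W] (f : U →ₗ[R] V) (g : V →ₗ[R] W)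
    (hfg : ∀ v, g v = 0 → ∃ u, f u = v) (hU : IsUniformlySTorsion S U)
    (hW : IsUniformlySTorsion S W) : IsUniformlySTorsion S V := by
  obtain ⟨s, hs, hsU⟩ := hU
  obtain ⟨t, ht, htW⟩ := hW
  refine ⟨s * t, S.mul_mem hs ht, fun v ↦ ?_⟩
  obtain ⟨u, hu⟩ := hfg (t • v) (by rw [map_smul, htW])
  rw [mul_smul, ← hu, ← map_smul, hsU, map_zero]

/-- The obstruction to extending φ is its connecting image in Ext¹, which s kills. -/
lemma exists_extension_of_shortExact {T : ShortComplex (ModuleCat.{u} R)} {X : ModuleCat.{u} R}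
    (h : T.ShortExact) (H : IsUniformlySTorsion S (Ext T.X₃ X 1)) :
    ∃ s ∈ S, ∀ φ : T.X₁ ⟶ X, ∃ ψ : T.X₂ ⟶ X, T.f ≫ ψ = s • φ := by
  obtain ⟨s, hs, H⟩ := H
  refine ⟨s, hs, fun φ ↦ ?_⟩
  obtain ⟨x, hx⟩ := Ext.contravariant_sequence_exact₁ h X (Ext.mk₀ (s • φ)) (add_zero 1) (by
    rw [Ext.mk₀_smul, Ext.comp_smul, H])
  obtain ⟨ψ, rfl⟩ := (Ext.mk₀_bijective _ _).2 x
  exact ⟨ψ, (Ext.mk₀_bijective _ _).1 (by rw [← Ext.mk₀_comp_mk₀, hx])⟩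

lemma isUniformlySTorsion_ext_one {T : ShortComplex (ModuleCat.{u} R)} {X : ModuleCat.{u} R}
    (h : T.ShortExact) [Projective T.X₂]
    (H : ∃ s ∈ S, ∀ φ : T.X₁ ⟶ X, ∃ ψ : T.X₂ ⟶ X, T.f ≫ ψ = s • φ) :
    IsUniformlySTorsion S (Ext T.X₃ X 1) := by
  obtain ⟨s, hs, H⟩ := H
  refine ⟨s, hs, fun e ↦ ?_⟩
  obtain ⟨x, rfl⟩ := Ext.contravariant_sequence_exact₃ h X e (Ext.eq_zero_of_projective _)
    (add_zero 1)
  obtain ⟨φ, rfl⟩ := (Ext.mk₀_bijective _ _).2 x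
  obtain ⟨ψ, hψ⟩ := H φ
  rw [← Ext.comp_smul, ← Ext.mk₀_smul, ← hψ, ← Ext.mk₀_comp_mk₀, h.extClass_comp_assoc]

end Torsion

/-- `Ext^k(N, X)` is uniformly `S`-torsion. -/
def ExtTorsion {R : Type u} [CommRing R] (S : Submonoid R) (k : ℕ) (N X : Type u)
    [AddCommGroup N] [Module R N] [AddCommGroup X] [Module R X] : Prop :=
  IsUniformlySTorsion S (Ext (ModuleCat.of R N) (ModuleCat.of R X) k)

namespace ExtTorsion

variable {R : Type u} [CommRing R] {S : Submonoid R}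

section

variable {A B C : Type u} [AddCommGroup A] [Module R A] [AddCommGroup B] [Module R B]
  [AddCommGroup C] [Module R C] {f : A →ₗ[R] B} {g : B →ₗ[R] C}

lemma shortExact (hf : Function.Injective f) (hfg : Function.Exact f g)
    (hg : Function.Surjective g) :
    (ShortComplex.moduleCatMk f g hfg.linearMap_comp_eq_zero).ShortExact :=
  ModuleCat.shortComplex_shortExact _ hfg hf hg

variable {N X : Type u} [AddCommGroup N] [Module R N] [AddCommGroup X] [Module R X]

/-- The `contra_*` and `co_*` lemmas each read three consecutive terms of a long exact sequence, in
the first or second argument of Ext; the suffix names the module whose Ext is concluded to be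
torsion. -/
lemma contra_left (hf : Function.Injective f) (hfg : Function.Exact f g)
    (hg : Function.Surjective g) {k : ℕ} (hB : ExtTorsion S k B X)
    (hC : ExtTorsion S (k + 1) C X) : ExtTorsion S k A X := by
  have h := shortExact hf hfg hg
  exact isUniformlySTorsion_of_exact
    (Ext.precompOfLinear (Ext.mk₀ (ModuleCat.ofHom f)) R (ModuleCat.of R X) (zero_add k))
    (Ext.precompOfLinear h.extClass R (ModuleCat.of R X) (add_comm 1 k))
    (fun v hv ↦ Ext.contravariant_sequence_exact₁ h _ v (add_comm 1 k) hv) hB hC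

lemma contra_right (hf : Function.Injective f) (hfg : Function.Exact f g)
    (hg : Function.Surjective g) {k : ℕ} (hA : ExtTorsion S k A X)
    (hB : ExtTorsion S (k + 1) B X) : ExtTorsion S (k + 1) C X := by
  have h := shortExact hf hfg hg
  exact isUniformlySTorsion_of_exact
    (Ext.precompOfLinear h.extClass R (ModuleCat.of R X) (add_comm 1 k))
    (Ext.precompOfLinear (Ext.mk₀ (ModuleCat.ofHom g)) R (ModuleCat.of R X) (zero_add (k + 1)))
    (fun v hv ↦ Ext.contravariant_sequence_exact₃ h _ v hv (add_comm 1 k)) hA hB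

lemma co_left (hf : Function.Injective f) (hfg : Function.Exact f g)
    (hg : Function.Surjective g) {k : ℕ} (hC : ExtTorsion S k N C)
    (hB : ExtTorsion S (k + 1) N B) : ExtTorsion S (k + 1) N A := by
  have h := shortExact hf hfg hg
  exact isUniformlySTorsion_of_exact
    (Ext.postcompOfLinear h.extClass R (ModuleCat.of R N) (rfl : k + 1 = k + 1))
    (Ext.postcompOfLinear (Ext.mk₀ (ModuleCat.ofHom f)) R (ModuleCat.of R N) (add_zero (k + 1)))
    (fun v hv ↦ Ext.covariant_sequence_exact₁ _ h v hv rfl) hC hB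

lemma co_middle (hf : Function.Injective f) (hfg : Function.Exact f g)
    (hg : Function.Surjective g) {k : ℕ} (hA : ExtTorsion S k N A)
    (hC : ExtTorsion S k N C) : ExtTorsion S k N B := by
  have h := shortExact hf hfg hg
  exact isUniformlySTorsion_of_exact
    (Ext.postcompOfLinear (Ext.mk₀ (ModuleCat.ofHom f)) R (ModuleCat.of R N) (add_zero k))
    (Ext.postcompOfLinear (Ext.mk₀ (ModuleCat.ofHom g)) R (ModuleCat.of R N) (add_zero k))
    (fun v hv ↦ Ext.covariant_sequence_exact₂ _ h v hv) hA hC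

lemma co_right (hf : Function.Injective f) (hfg : Function.Exact f g)
    (hg : Function.Surjective g) {k : ℕ} (hB : ExtTorsion S k N B)
    (hA : ExtTorsion S (k + 1) N A) : ExtTorsion S k N C := by
  have h := shortExact hf hfg hg
  exact isUniformlySTorsion_of_exact
    (Ext.postcompOfLinear (Ext.mk₀ (ModuleCat.ofHom g)) R (ModuleCat.of R N) (add_zero k))
    (Ext.postcompOfLinear h.extClass R (ModuleCat.of R N) (rfl : k + 1 = k + 1))
    (fun v hv ↦ Ext.covariant_sequence_exact₃ _ h v rfl hv) hB hA

/-- If `Ext^1(C, X)` is uniformly `S`-torsion, then some multiple `s • φ` of each `φ : A → X`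
extends to `B`, with `s` independent of `φ`. -/
lemma exists_extension (hf : Function.Injective f) (hfg : Function.Exact f g)
    (hg : Function.Surjective g) (H : ExtTorsion S 1 C X) :
    ∃ s ∈ S, ∀ φ : A →ₗ[R] X, ∃ ψ : B →ₗ[R] X, ψ.comp f = s • φ := by
  obtain ⟨s, hs, H⟩ := exists_extension_of_shortExact (shortExact hf hfg hg) H
  refine ⟨s, hs, fun φ ↦ ?_⟩
  obtain ⟨ψ, hψ⟩ := H (ModuleCat.ofHom φ)
  exact ⟨ψ.hom, congrArg ModuleCat.Hom.hom hψ⟩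

/-- If `B` is projective, `Ext^1(C, X)` is the cokernel of `Hom(B, X) → Hom(A, X)`. -/
lemma one_iff [Module.Projective R B] (hf : Function.Injective f) (hfg : Function.Exact f g)
    (hg : Function.Surjective g) :
    ExtTorsion S 1 C X ↔ ∃ s ∈ S, ∀ φ : A →ₗ[R] X, ∃ ψ : B →ₗ[R] X, ψ.comp f = s • φ := by
  refine ⟨exists_extension hf hfg hg, ?_⟩
  rintro ⟨s, hs, H⟩
  have h : Projective (ModuleCat.of R B) := (IsProjective.iff_projective _).mp inferInstance
  refine @isUniformlySTorsion_ext_one _ _ _ _ (ModuleCat.of R X) (shortExact hf hfg hg) h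
    ⟨s, hs, fun φ ↦ ?_⟩
  obtain ⟨ψ, hψ⟩ := H φ.hom
  exact ⟨ModuleCat.ofHom ψ, ModuleCat.hom_ext hψ⟩

lemma of_projective [Module.Projective R N] (k : ℕ) : ExtTorsion S (k + 1) N X := by
  have : Projective (ModuleCat.of R N) := (IsProjective.iff_projective _).mp inferInstance
  exact ⟨1, S.one_mem, fun e ↦ by rw [Ext.eq_zero_of_projective e, smul_zero]⟩

lemma of_injective [Module.Injective R X] (k : ℕ) : ExtTorsion S (k + 1) N X := by
  have : Injective (ModuleCat.of R X) := Module.injective_object_of_injective_module R X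
  exact ⟨1, S.one_mem, fun e ↦ by rw [Ext.eq_zero_of_injective e, smul_zero]⟩

lemma of_isUniformlySTorsion (hX : IsUniformlySTorsion S X) (k : ℕ) : ExtTorsion S k N X := by
  obtain ⟨s, hs, H⟩ := hX
  refine ⟨s, hs, fun e ↦ ?_⟩
  have : s • 𝟙 (ModuleCat.of R X) = 0 := by ext x; exact H x
  rw [Ext.smul_eq_comp_mk₀, this, Ext.mk₀_zero, Ext.comp_zero]

/-- Dimension shifting along a projective middle term. -/
lemma succ_iff [Module.Projective R B] (hf : Function.Injective f) (hfg : Function.Exact f g)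
    (hg : Function.Surjective g) (k : ℕ) :
    ExtTorsion S (k + 2) C X ↔ ExtTorsion S (k + 1) A X :=
  ⟨fun h ↦ contra_left hf hfg hg (of_projective k) h,
    fun h ↦ contra_right hf hfg hg h (of_projective _)⟩

lemma one_iff_ker [Module.Projective R B] (hg : Function.Surjective g) :
    ExtTorsion S 1 C X ↔
      ∃ s ∈ S, ∀ φ : g.ker →ₗ[R] X, ∃ ψ : B →ₗ[R] X, ψ.comp g.ker.subtype = s • φ :=
  one_iff g.ker.injective_subtype g.exact_subtype_ker_map hg

lemma succ_iff_ker [Module.Projective R B] (hg : Function.Surjective g) (k : ℕ) :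
    ExtTorsion S (k + 2) C X ↔ ExtTorsion S (k + 1) g.ker X :=
  succ_iff g.ker.injective_subtype g.exact_subtype_ker_map hg k

end

end ExtTorsion

lemma exists_free_cover (R : Type u) [CommRing R] (N : Type u) [AddCommGroup N] [Module R N] :
    ∃ (P : Type u) (_ : AddCommGroup P) (_ : Module R P) (p : P →ₗ[R] N),
      Module.Free R P ∧ Function.Surjective p :=
  ⟨N →₀ R, inferInstance, inferInstance, Finsupp.linearCombination R id, inferInstance,
    Finsupp.linearCombination_id_surjective R N⟩

end Ext

/-! ### S-flatness through character modules -/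

section Flat

variable {R : Type u} [CommRing R] {S : Submonoid R}

section

variable {A B C : Type u} [AddCommGroup A] [Module R A] [AddCommGroup B] [Module R B]
  [AddCommGroup C] [Module R C]

lemma sExact_zero_left_iff {f : A →ₗ[R] B} :
    SExact S (0 : PUnit.{u+1} →ₗ[R] A) f ↔ ∃ s ∈ S, ∀ x, f x = 0 → s • x = 0 := by
  simp only [SExact, LinearMap.range_zero, LinearMap.mem_ker, Submodule.mem_bot]
  refine ⟨fun ⟨s, hs, h, _⟩ ↦ ⟨s, hs, h⟩, fun ⟨s, hs, h⟩ ↦ ⟨s, hs, h, ?_⟩⟩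
  rintro y rfl
  simp

lemma sExact_zero_right_iff {g : B →ₗ[R] C} :
    SExact S g (0 : C →ₗ[R] PUnit.{u+1}) ↔ ∃ s ∈ S, ∀ y, ∃ x, g x = s • y := by
  simp only [SExact, LinearMap.ker_zero, Submodule.mem_top, true_implies, LinearMap.mem_range]
  exact ⟨fun ⟨s, hs, h, _⟩ ↦ ⟨s, hs, h⟩, fun ⟨s, hs, h⟩ ↦ ⟨s, hs, h, fun _ _ ↦ trivial⟩⟩

lemma SExact.of_exact {f : A →ₗ[R] B} {g : B →ₗ[R] C} (h : Function.Exact f g) : SExact S f g :=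
  ⟨1, S.one_mem, fun y hy ↦ by simpa using (h y).1 hy, fun y hy ↦ by
    simpa using (h y).2 hy⟩

/-- The usual proof of right exactness: invert g modulo the image of f, here only up to a factor,
and tensor the result. -/
lemma SExact.rTensor {f : A →ₗ[R] B} {g : B →ₗ[R] C} (F : Type u) [AddCommGroup F] [Module R F]
    (h : SExact S f g) (hg : SExact S g (0 : C →ₗ[R] PUnit.{u+1})) :
    SExact S (f.rTensor F) (g.rTensor F) := by
  obtain ⟨s, hs, hfg, hgf⟩ := h
  obtain ⟨t, ht, hg⟩ := sExact_zero_right_iff.1 hg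
  choose b hb using hg
  have key (x y : B) (hxy : g x = g y) :
      f.range.mkQ (s • x) = f.range.mkQ (s • y) := by
    rw [← sub_eq_zero, ← map_sub, ← smul_sub]
    exact (Submodule.Quotient.mk_eq_zero _).2 (hfg _ (by simp [hxy]))
  -- division by `g`, up to the factor `s * t`
  let h : C →ₗ[R] B ⧸ f.range :=
    { toFun := fun c ↦ f.range.mkQ (s • b c)
      map_add' := fun c c' ↦ by
        rw [← map_add, ← smul_add]
        exact key _ _ (by simp [hb])
      map_smul' := fun r c ↦ by
        rw [RingHom.id_apply, ← map_smul, smul_comm r s]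
        exact key _ _ (by simp [hb, smul_comm r t]) }
  have hh : h.comp g = (s * t) • f.range.mkQ := by
    ext x
    change f.range.mkQ (s • b (g x)) = (s * t) • f.range.mkQ x
    rw [mul_smul, ← map_smul, ← map_smul]
    exact key _ _ (by simp [hb])
  have hex : Function.Exact (f.rTensor F) (f.range.mkQ.rTensor F) :=
    rTensor_exact F (fun y ↦ by simp) (Submodule.mkQ_surjective _)
  -- The factor s * t comes from `hh`; the extra s serves the other inclusion, where s kills g ∘ f.
  refine ⟨s * (s * t), S.mul_mem hs (S.mul_mem hs ht), fun y hy ↦ ?_, ?_⟩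
  · rw [mul_smul]
    refine Submodule.smul_mem _ _ ((hex _).1 ?_)
    have := congrArg (h.rTensor F) (LinearMap.mem_ker.1 hy)
    rw [map_zero, ← LinearMap.comp_apply, ← LinearMap.rTensor_comp, hh,
      LinearMap.rTensor_smul] at this
    rw [map_smul]
    exact this
  · rintro _ ⟨x, rfl⟩
    have h0 : s • g.comp f = 0 := by
      ext x
      have := hgf (f x) ⟨x, rfl⟩
      simpa using this
    rw [LinearMap.mem_ker, mul_comm, mul_smul, map_smul, map_smul, ← LinearMap.comp_apply,
      ← LinearMap.rTensor_comp, ← LinearMap.smul_apply, ← LinearMap.rTensor_smul, h0,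
      LinearMap.rTensor_zero, LinearMap.zero_apply, smul_zero]

lemma SExact.rTensor_right {g : B →ₗ[R] C} (F : Type u) [AddCommGroup F] [Module R F]
    (hg : SExact S g (0 : C →ₗ[R] PUnit.{u+1})) :
    SExact S (g.rTensor F) (0 : C ⊗[R] F →ₗ[R] PUnit.{u+1}) := by
  rw [sExact_zero_right_iff] at hg ⊢
  obtain ⟨t, ht, hg⟩ := hg
  refine ⟨t, ht, fun y ↦ ?_⟩
  induction y with
  | zero => exact ⟨0, by simp⟩
  | tmul c x =>
    obtain ⟨b, hb⟩ := hg c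
    exact ⟨b ⊗ₜ x, by simp [hb, TensorProduct.smul_tmul']⟩
  | add x y hx hy =>
    obtain ⟨x', hx⟩ := hx
    obtain ⟨y', hy⟩ := hy
    exact ⟨x' + y', by simp [hx, hy]⟩

end

/-- `S`-flatness is a condition on injective maps only. -/
lemma isSFlat_iff_injective (F : Type u) [AddCommGroup F] [Module R F] :
    IsSFlat S F ↔ ∀ (A B : Type u) [AddCommGroup A] [AddCommGroup B] [Module R A] [Module R B]
      (f : A →ₗ[R] B), Function.Injective f →
        ∃ s ∈ S, ∀ z, f.rTensor F z = 0 → s • z = 0 := by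
  constructor
  · intro h A B _ _ _ _ f hf
    exact sExact_zero_left_iff.1 (h A B (B ⧸ f.range) f f.range.mkQ
      ⟨sExact_zero_left_iff.2 ⟨1, S.one_mem, fun x hx ↦ by simp [hf (hx.trans f.map_zero.symm)]⟩,
        SExact.of_exact (fun y ↦ by simp), sExact_zero_right_iff.2 ⟨1, S.one_mem, fun y ↦ by
          simpa using Submodule.mkQ_surjective _ y⟩⟩).left
  · intro h A B C _ _ _ _ _ _ f g hfg
    refine ⟨sExact_zero_left_iff.2 ?_, hfg.middle.rTensor F hfg.right, hfg.right.rTensor_right F⟩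
    -- Factor f through its image: t handles the inclusion, while the kernel of the tensored
    -- surjection comes from ker f ⊗ F, killed by s.
    obtain ⟨s, hs, hsf⟩ := sExact_zero_left_iff.1 hfg.left
    obtain ⟨t, ht, htf⟩ := h _ _ f.range.subtype f.range.injective_subtype
    refine ⟨s * t, S.mul_mem hs ht, fun z hz ↦ ?_⟩
    have h1 : f.rangeRestrict.rTensor F (t • z) = 0 := by
      rw [map_smul]
      refine htf _ ?_
      rw [← LinearMap.comp_apply, ← LinearMap.rTensor_comp]
      exact hz
    have hex : Function.Exact (f.ker.subtype.rTensor F) (f.rangeRestrict.rTensor F) :=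
      rTensor_exact F (fun y ↦ by simp [Subtype.ext_iff]) f.surjective_rangeRestrict
    obtain ⟨w, hw⟩ := (hex _).1 h1
    have h0 : s • f.ker.subtype = 0 := by
      ext ⟨x, hx⟩
      exact hsf x hx
    rw [mul_smul, ← hw, ← LinearMap.smul_apply, ← LinearMap.rTensor_smul, h0,
      LinearMap.rTensor_zero, LinearMap.zero_apply]

lemma IsUniformlySTorsion.characterModule {M : Type u} [AddCommGroup M] [Module R M]
    (h : IsUniformlySTorsion S M) : IsUniformlySTorsion S (CharacterModule M) := by
  obtain ⟨s, hs, h⟩ := h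
  exact ⟨s, hs, fun c ↦ CharacterModule.ext _ fun x ↦ by
    rw [CharacterModule.smul_apply, h]; exact c.map_zero⟩

lemma CharacterModule.dual_exact {A B C : Type u} [AddCommGroup A] [Module R A] [AddCommGroup B]
    [Module R B] [AddCommGroup C] [Module R C] {f : A →ₗ[R] B} {g : B →ₗ[R] C}
    (hfg : Function.Exact f g) (hg : Function.Surjective g) :
    Function.Exact (CharacterModule.dual g) (CharacterModule.dual f) := by
  intro c
  constructor
  · intro hc
    let c' : B →+ AddCircle (1 : ℚ) := c
    have hker : g.toAddMonoidHom.ker ≤ c'.ker := by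
      intro x hx
      obtain ⟨y, rfl⟩ := (hfg x).1 hx
      exact DFunLike.congr_fun hc y
    refine ⟨AddMonoidHom.liftOfSurjective g.toAddMonoidHom hg ⟨c', hker⟩, ?_⟩
    exact CharacterModule.ext _ fun x ↦
      AddMonoidHom.liftOfRightInverse_comp_apply g.toAddMonoidHom _
        (Function.rightInverse_surjInv hg) ⟨c', hker⟩ x
  · rintro ⟨d, rfl⟩
    refine CharacterModule.ext _ fun x ↦ ?_
    change d (g (f x)) = 0
    rw [hfg.apply_apply_eq_zero]
    exact d.map_zero

/-- A character vanishing on the kernel of `f` extends along `f`. -/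
lemma CharacterModule.exists_dual_eq {A B : Type u} [AddCommGroup A] [Module R A]
    [AddCommGroup B] [Module R B] (f : A →ₗ[R] B) (c : CharacterModule A)
    (hc : ∀ x, f x = 0 → c x = 0) : ∃ d, CharacterModule.dual f d = c := by
  have hex : Function.Exact f.ker.subtype f.rangeRestrict :=
    LinearMap.exact_iff.2 (by rw [LinearMap.ker_rangeRestrict, Submodule.range_subtype])
  obtain ⟨d, rfl⟩ := (CharacterModule.dual_exact hex f.surjective_rangeRestrict c).1
    (CharacterModule.ext _ fun x ↦ hc x x.2)
  obtain ⟨d, rfl⟩ := CharacterModule.dual_surjective_of_injective _ f.range.injective_subtype d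
  exact ⟨d, rfl⟩

/-- All `Ext^{n+1}(N, M⋆)` are uniformly `S`-torsion, `M⋆` being the character module of `M`.
By duality this says that all `Tor_{n+1}(N, M)` are. -/
def TorTorsionAbove (S : Submonoid R) (n : ℕ) (M : Type u) [AddCommGroup M] [Module R M] : Prop :=
  ∀ (N : Type u) [AddCommGroup N] [Module R N], ExtTorsion S (n + 1) N (CharacterModule M)

/-- Under Hom(A, F⋆) ≅ (A ⊗ F)⋆, extending s • φ along f means extending s • c along f ⊗ F. This is
possible for all characters c iff s kills ker(f ⊗ F), as characters extend and separate points. -/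
lemma isSFlat_iff_torTorsionAbove (F : Type u) [AddCommGroup F] [Module R F] :
    IsSFlat S F ↔ TorTorsionAbove S 0 F := by
  rw [isSFlat_iff_injective]
  constructor
  · intro h N _ _
    obtain ⟨P, _, _, p, _, hp⟩ := exists_free_cover R N
    refine (ExtTorsion.one_iff_ker hp).2 ?_
    obtain ⟨s, hs, H⟩ := h _ _ p.ker.subtype p.ker.injective_subtype
    refine ⟨s, hs, fun φ ↦ ?_⟩
    let c := CharacterModule.homEquiv φ
    let i := p.ker.subtype.rTensor F
    obtain ⟨d', hc⟩ := CharacterModule.exists_dual_eq i (s • c) fun z hz ↦ by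
      rw [CharacterModule.smul_apply, H z hz]
      exact c.map_zero
    refine ⟨CharacterModule.homEquiv.symm d', ?_⟩
    calc _ = CharacterModule.homEquiv.symm (CharacterModule.dual i d') := rfl
      _ = s • φ := by rw [hc, map_smul, LinearEquiv.symm_apply_apply]
  · intro h A B _ _ _ _ f hf
    obtain ⟨s, hs, H⟩ := ExtTorsion.exists_extension hf (g := f.range.mkQ) (fun y ↦ by simp)
      (Submodule.mkQ_surjective _) (h _)
    refine ⟨s, hs, fun z hz ↦ CharacterModule.eq_zero_of_character_apply fun c ↦ ?_⟩
    obtain ⟨ψ, hψ⟩ := H (CharacterModule.homEquiv.symm c)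
    have h1 : CharacterModule.dual (f.rTensor F) (CharacterModule.homEquiv ψ) = s • c := by
      apply CharacterModule.homEquiv.symm.injective
      rw [map_smul, ← hψ]
      exact LinearMap.congr_fun (CharacterModule.dual_rTensor_conj_homEquiv _ (B := F) f) ψ
    have h2 := DFunLike.congr_fun h1 z
    rw [CharacterModule.smul_apply] at h2
    rw [← h2, CharacterModule.dual_apply]
    change (CharacterModule.homEquiv ψ) (f.rTensor F z) = 0
    rw [hz]
    exact map_zero _

end Flat

/-! ### S-flat dimension through Ext -/

section Dimension

variable {R : Type u} [CommRing R] {S : Submonoid R}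

namespace TorTorsionAbove

lemma of_isUniformlySTorsion {M : Type u} [AddCommGroup M] [Module R M]
    (h : IsUniformlySTorsion S M) (n : ℕ) : TorTorsionAbove S n M :=
  fun _ _ _ ↦ .of_isUniformlySTorsion h.characterModule _

/-- Pass to the first syzygy of N; the hypothesis covers all modules. So one degree controls all
higher ones. -/
lemma succ {M : Type u} [AddCommGroup M] [Module R M] {n : ℕ} (h : TorTorsionAbove S n M) :
    TorTorsionAbove S (n + 1) M := by
  intro N _ _
  obtain ⟨P, _, _, p, _, hp⟩ := exists_free_cover R N
  exact (ExtTorsion.succ_iff_ker hp n).2 (h p.ker)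

lemma mono {M : Type u} [AddCommGroup M] [Module R M] {m n : ℕ} (hmn : m ≤ n)
    (h : TorTorsionAbove S m M) : TorTorsionAbove S n M := by
  induction n, hmn using Nat.le_induction with
  | base => exact h
  | succ n _ ih => exact ih.succ

lemma of_projective {M : Type u} [AddCommGroup M] [Module R M] [Module.Projective R M] (n : ℕ) :
    TorTorsionAbove S n M := by
  intro N _ _
  have : Module.Injective R (CharacterModule M) :=
    Module.Flat.iff_characterModule_injective.1 inferInstance
  exact .of_injective n

section

variable {A B C : Type u} [AddCommGroup A] [Module R A] [AddCommGroup B] [Module R B]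
  [AddCommGroup C] [Module R C] {f : A →ₗ[R] B} {g : B →ₗ[R] C}

/-- Dualizing reverses the sequence to 0 → C⋆ → B⋆ → A⋆ → 0. -/
lemma left_of_exact (hf : Function.Injective f) (hfg : Function.Exact f g)
    (hg : Function.Surjective g) {n : ℕ} (hB : TorTorsionAbove S n B)
    (hC : TorTorsionAbove S (n + 1) C) : TorTorsionAbove S n A := fun N _ _ ↦
  .co_right (CharacterModule.dual_injective_of_surjective g hg)
    (CharacterModule.dual_exact hfg hg) (CharacterModule.dual_surjective_of_injective f hf)
    (hB N) (hC N)

lemma middle_of_exact (hf : Function.Injective f) (hfg : Function.Exact f g)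
    (hg : Function.Surjective g) {n : ℕ} (hA : TorTorsionAbove S n A)
    (hC : TorTorsionAbove S n C) : TorTorsionAbove S n B := fun N _ _ ↦
  .co_middle (CharacterModule.dual_injective_of_surjective g hg)
    (CharacterModule.dual_exact hfg hg) (CharacterModule.dual_surjective_of_injective f hf)
    (hC N) (hA N)

lemma right_of_exact (hf : Function.Injective f) (hfg : Function.Exact f g)
    (hg : Function.Surjective g) {n : ℕ} (hA : TorTorsionAbove S n A)
    (hB : TorTorsionAbove S (n + 1) B) : TorTorsionAbove S (n + 1) C := fun N _ _ ↦
  .co_left (CharacterModule.dual_injective_of_surjective g hg)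
    (CharacterModule.dual_exact hfg hg) (CharacterModule.dual_surjective_of_injective f hf)
    (hA N) (hB N)

/-- A torsion left term costs no degree, unlike in `right_of_exact`. -/
lemma right_of_torsion_left (hf : Function.Injective f) (hfg : Function.Exact f g)
    (hg : Function.Surjective g) {n : ℕ} (hA : IsUniformlySTorsion S A)
    (hB : TorTorsionAbove S n B) : TorTorsionAbove S n C := fun N _ _ ↦
  .co_left (CharacterModule.dual_injective_of_surjective g hg)
    (CharacterModule.dual_exact hfg hg) (CharacterModule.dual_surjective_of_injective f hf)
    (.of_isUniformlySTorsion hA.characterModule _) (hB N)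

lemma iff_of_torsion_quotient {A B : Submodule R C} (hAB : A ≤ B) {s : R} (hs : s ∈ S)
    (h : ∀ x ∈ B, s • x ∈ A) {n : ℕ} : TorTorsionAbove S n A ↔ TorTorsionAbove S n B := by
  let i := Submodule.inclusion hAB
  have hex : Function.Exact i i.range.mkQ :=
    LinearMap.exact_iff.2 (by rw [Submodule.ker_mkQ])
  have hi : Function.Injective i := Submodule.inclusion_injective hAB
  have hq : IsUniformlySTorsion S (B ⧸ i.range) := by
    refine ⟨s, hs, fun t ↦ ?_⟩
    obtain ⟨x, rfl⟩ := Submodule.mkQ_surjective _ t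
    rw [← map_smul]
    exact (Submodule.Quotient.mk_eq_zero _).2 ⟨⟨_, h x x.2⟩, rfl⟩
  exact ⟨fun hA ↦ middle_of_exact hi hex (Submodule.mkQ_surjective _) hA
    (of_isUniformlySTorsion hq n), fun hB ↦ left_of_exact hi hex (Submodule.mkQ_surjective _) hB
    (of_isUniformlySTorsion hq _)⟩

lemma of_range (hg : SExact S g (0 : C →ₗ[R] PUnit.{u+1})) {n : ℕ}
    (h : TorTorsionAbove S n g.range) : TorTorsionAbove S n C := by
  obtain ⟨s, hs, H⟩ := sExact_zero_right_iff.1 hg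
  refine middle_of_exact g.range.injective_subtype (g := g.range.mkQ)
    (LinearMap.exact_iff.2 (by rw [Submodule.ker_mkQ, Submodule.range_subtype]))
    (Submodule.mkQ_surjective _) h (of_isUniformlySTorsion ⟨s, hs, fun t ↦ ?_⟩ n)
  obtain ⟨x, rfl⟩ := Submodule.mkQ_surjective _ t
  rw [← map_smul]
  exact (Submodule.Quotient.mk_eq_zero _).2 (H x)

lemma exact_subtype_rangeRestrict (g : B →ₗ[R] C) :
    Function.Exact g.ker.subtype g.rangeRestrict :=
  LinearMap.exact_iff.2 (by rw [LinearMap.ker_rangeRestrict, Submodule.range_subtype])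

lemma of_ker (hg : SExact S g (0 : C →ₗ[R] PUnit.{u+1})) {n : ℕ}
    (hker : TorTorsionAbove S n g.ker) (hB : TorTorsionAbove S (n + 1) B) :
    TorTorsionAbove S (n + 1) C :=
  of_range hg (right_of_exact g.ker.injective_subtype (exact_subtype_rangeRestrict g)
    g.surjective_rangeRestrict hker hB)

lemma of_torsion_ker (hg : SExact S g (0 : C →ₗ[R] PUnit.{u+1})) {n : ℕ}
    (hker : IsUniformlySTorsion S g.ker) (hB : TorTorsionAbove S n B) :
    TorTorsionAbove S n C :=
  of_range hg (right_of_torsion_left g.ker.injective_subtype (exact_subtype_rangeRestrict g)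
    g.surjective_rangeRestrict hker hB)

end

end TorTorsionAbove

namespace SFlatSResolution

/-- Forget the first term of a resolution. -/
def tail {M : Type u} [AddCommGroup M] [Module R M] {n : ℕ}
    (r : SFlatSResolution S M (n + 1)) : SFlatSResolution S (r.d 0).range n where
  F i := r.F (i + 1)
  d i := r.d (i + 1)
  ε := (r.d 0).rangeRestrict
  flat i hi := r.flat (i + 1) (by lia)
  zero i hi := r.zero (i + 1) (by lia)
  exact_M := sExact_zero_right_iff.2 ⟨1, S.one_mem, fun y ↦ by
    simpa using (r.d 0).surjective_rangeRestrict y⟩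
  exact_zero := by
    have := r.exact_succ 0
    rwa [SExact, ← LinearMap.ker_rangeRestrict (r.d 0)] at this
  exact_succ i := r.exact_succ (i + 1)

/-- Splice a resolution of the kernel of an epimorphism from an `S`-flat module. -/
def cons {M P : Type u} [AddCommGroup M] [Module R M] [AddCommGroup P] [Module R P]
    (p : P →ₗ[R] M) (hp : Function.Surjective p) (hP : IsSFlat S P) {n : ℕ}
    (r : SFlatSResolution S p.ker n) : SFlatSResolution S M (n + 1) where
  F | 0 => ModuleCat.of R P
    | i + 1 => r.F i
  d | 0 => p.ker.subtype.comp r.ε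
    | i + 1 => r.d i
  ε := p
  flat
    | 0, _ => hP
    | i + 1, hi => r.flat i (by lia)
  zero
    | 0, hi => by lia
    | i + 1, hi => r.zero i (by lia)
  exact_M := sExact_zero_right_iff.2 ⟨1, S.one_mem, fun y ↦ by simpa using hp y⟩
  exact_zero := by
    obtain ⟨s, hs, h⟩ := sExact_zero_right_iff.1 r.exact_M
    refine ⟨s, hs, fun y hy ↦ ?_, ?_⟩
    · obtain ⟨x, hx⟩ := h ⟨y, hy⟩
      exact ⟨x, congrArg Subtype.val hx⟩
    · rintro _ ⟨x, rfl⟩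
      exact Submodule.smul_mem _ _ (r.ε x).2
  exact_succ
    | 0 => by
      have := r.exact_zero
      rwa [SExact, ← LinearMap.ker_comp_of_ker_eq_bot r.ε p.ker.ker_subtype] at this
    | i + 1 => r.exact_succ i

/-- An `S`-flat module as its own resolution. -/
def single {M : Type u} [AddCommGroup M] [Module R M] (hM : IsSFlat S M) :
    SFlatSResolution S M 0 where
  F | 0 => ModuleCat.of R M
    | _ + 1 => ModuleCat.of R PUnit
  d _ := 0
  ε := LinearMap.id
  flat
    | 0, _ => hM
  zero
    | _ + 1, _ => inferInstanceAs (Subsingleton PUnit)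
  exact_M := sExact_zero_right_iff.2 ⟨1, S.one_mem, fun y ↦ ⟨_, rfl⟩⟩
  exact_zero := .of_exact fun y ↦ by simp [eq_comm]
  exact_succ _ := .of_exact fun y ↦ ⟨fun _ ↦ ⟨0, Subsingleton.elim (α := PUnit) _ _⟩, fun _ ↦ rfl⟩

lemma torTorsionAbove {M : Type u} [AddCommGroup M] [Module R M] {n : ℕ}
    (r : SFlatSResolution S M n) : TorTorsionAbove S n M := by
  induction n generalizing M with
  | zero =>
    obtain ⟨s, hs, h1, h2⟩ := r.exact_zero
    refine .of_torsion_ker r.exact_M ⟨s, hs, fun x ↦ ?_⟩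
      ((isSFlat_iff_torTorsionAbove _).1 (r.flat 0 le_rfl))
    -- Here F 1 = 0, so s kills ker ε.
    obtain ⟨y, hy⟩ := h1 x x.2
    have := r.zero 1 one_pos
    rw [Subsingleton.elim y 0, map_zero] at hy
    exact Subtype.ext hy.symm
  | succ n ih =>
    obtain ⟨s, hs, h1, h2⟩ := r.exact_zero
    have hF := (isSFlat_iff_torTorsionAbove _).1 (r.flat 0 (Nat.zero_le _))
    refine .of_ker r.exact_M ?_ (hF.mono (Nat.zero_le _))
    -- Neither of im d₀ and ker ε need contain the other; each is compared with their intersection.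
    have h := (TorTorsionAbove.iff_of_torsion_quotient (inf_le_left (a := (r.d 0).range)
      (b := r.ε.ker)) hs fun x hx ↦ ⟨Submodule.smul_mem _ _ hx, h2 x hx⟩).2 (ih r.tail)
    exact (TorTorsionAbove.iff_of_torsion_quotient inf_le_right hs
      fun x hx ↦ ⟨h1 x hx, Submodule.smul_mem _ _ hx⟩).1 h

end SFlatSResolution

/-- Take free covers n times; the last syzygy is S-flat by dimension shifting. -/
lemma TorTorsionAbove.nonempty_resolution {M : Type u} [AddCommGroup M] [Module R M] {n : ℕ}
    (h : TorTorsionAbove S n M) : Nonempty (SFlatSResolution S M n) := by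
  induction n generalizing M with
  | zero => exact ⟨.single ((isSFlat_iff_torTorsionAbove M).2 h)⟩
  | succ n ih =>
    obtain ⟨P, _, _, p, _, hp⟩ := exists_free_cover R M
    obtain ⟨r⟩ := ih (left_of_exact p.ker.injective_subtype p.exact_subtype_ker_map hp
      (of_projective n) h)
    exact ⟨r.cons p hp ((isSFlat_iff_torTorsionAbove P).2 (of_projective 0))⟩

lemma sFlatDim_le_iff {M : Type u} [AddCommGroup M] [Module R M] {n : ℕ} :
    sFlatDim S M ≤ n ↔ TorTorsionAbove S n M := by
  constructor
  · intro h
    have hne : {k : ℕ∞ | ∃ n : ℕ, k = (n : ℕ∞) ∧ Nonempty (SFlatSResolution S M n)}.Nonempty := by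
      by_contra hempty
      rw [sFlatDim, Set.not_nonempty_iff_eq_empty.1 hempty, sInf_empty] at h
      exact ENat.natCast_ne_top n (top_le_iff.1 h)
    obtain ⟨m, hm, ⟨r⟩⟩ := csInf_mem hne
    rw [sFlatDim, hm, Nat.cast_le] at h
    exact r.torTorsionAbove.mono h
  · intro h
    exact sInf_le ⟨n, rfl, h.nonempty_resolution⟩

end Dimension

/-! ### Change of rings along R → R/a -/

section ChangeOfRings

variable {R : Type u} [CommRing R] {S : Submonoid R} {a : R}

instance CharacterModule.isScalarTower_quotient {I : Ideal R} {M : Type u} [AddCommGroup M]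
    [Module R M] [Module (R ⧸ I) M] [IsScalarTower R (R ⧸ I) M] :
    IsScalarTower R (R ⧸ I) (CharacterModule M) where
  smul_assoc r t c := CharacterModule.ext _ fun x ↦ by
    obtain ⟨t, rfl⟩ := Ideal.Quotient.mk_surjective t
    rw [CharacterModule.smul_apply, CharacterModule.smul_apply, CharacterModule.smul_apply]
    congr 1
    have h (r : R) (x : M) : Ideal.Quotient.mk I r • x = r • x := algebraMap_smul _ r x
    rw [smul_assoc, h, h, smul_comm]

/-- `p` exhibits `N'` as `N ⧸ a N`, and `a` is regular on `N`. -/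
structure IsRegularReduction (a : R) {N N' : Type u} [AddCommGroup N] [Module R N]
    [AddCommGroup N'] [Module R N'] (p : N →ₗ[R] N') : Prop where
  surjective : Function.Surjective p
  exists_smul_eq : ∀ x, p x = 0 → ∃ y, a • y = x
  regular : ∀ x : N, a • x = 0 → x = 0
  smul_eq_zero : ∀ y : N', a • y = 0

lemma quotient_smul_eq_zero {X : Type u} [AddCommGroup X] [Module R X]
    [Module (R ⧸ Ideal.span {a}) X] [IsScalarTower R (R ⧸ Ideal.span {a}) X] (x : X) :
    a • x = 0 := by
  rw [← algebraMap_smul (R ⧸ Ideal.span {a}) a x, Ideal.Quotient.algebraMap_eq,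
    Ideal.Quotient.eq_zero_iff_mem.2 (Ideal.mem_span_singleton_self a), zero_smul]

lemma exists_quotient_linearMap {I : Ideal R} {P Y X : Type u} [AddCommGroup P] [Module R P]
    [AddCommGroup Y] [Module R Y] [Module (R ⧸ I) Y] [IsScalarTower R (R ⧸ I) Y]
    [AddCommGroup X] [Module R X] [Module (R ⧸ I) X] [IsScalarTower R (R ⧸ I) X]
    (q : P →ₗ[R] Y) (hq : Function.Surjective q) (m : P →ₗ[R] X) (h : q.ker ≤ m.ker) :
    ∃ j : Y →ₗ[R ⧸ I] X, ∀ x, j (q x) = m x := by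
  let e := q.quotKerEquivOfSurjective hq
  refine ⟨LinearMap.extendScalarsOfSurjective (R := R) (S := R ⧸ I)
    Ideal.Quotient.mk_surjective ((q.ker.liftQ m h).comp e.symm.toLinearMap), fun x ↦ ?_⟩
  have : e.symm (q x) = q.ker.mkQ x := by
    rw [LinearEquiv.symm_apply_eq]
    rfl
  change q.ker.liftQ m h (e.symm (q x)) = m x
  rw [this]
  rfl

namespace IsRegularReduction

variable {N N' : Type u} [AddCommGroup N] [Module R N] [AddCommGroup N'] [Module R N']
  {p : N →ₗ[R] N'}

lemma exists_factor [Module (R ⧸ Ideal.span {a}) N'] [IsScalarTower R (R ⧸ Ideal.span {a}) N']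
    (hp : IsRegularReduction a p) {X : Type u} [AddCommGroup X] [Module R X]
    [Module (R ⧸ Ideal.span {a}) X] [IsScalarTower R (R ⧸ Ideal.span {a}) X] (φ : N →ₗ[R] X) :
    ∃ j : N' →ₗ[R ⧸ Ideal.span {a}] X, ∀ x, j (p x) = φ x := by
  refine exists_quotient_linearMap p hp.surjective φ fun x hx ↦ ?_
  obtain ⟨y, rfl⟩ := hp.exists_smul_eq x hx
  rw [LinearMap.mem_ker, map_smul, quotient_smul_eq_zero]

lemma finsupp (ha : a ∈ nonZeroDivisors R) (ι : Type u) :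
    IsRegularReduction a
      (Finsupp.mapRange.linearMap (α := ι) (Algebra.linearMap R (R ⧸ Ideal.span {a}))) where
  surjective := Finsupp.mapRange_surjective _ (map_zero _) Ideal.Quotient.mk_surjective
  exists_smul_eq x hx := by
    have h (i : ι) : ∃ r, a * r = x i := by
      have := DFunLike.congr_fun hx i
      obtain ⟨r, hr⟩ := Ideal.mem_span_singleton.1 (Ideal.Quotient.eq_zero_iff_mem.1 this)
      exact ⟨r, hr.symm⟩
    choose r hr using h
    refine ⟨Finsupp.onFinset x.support r fun i hi ↦ ?_, Finsupp.ext fun i ↦ hr i⟩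
    rw [Finsupp.mem_support_iff, ← hr]
    exact fun h0 ↦ hi ((mul_left_mem_nonZeroDivisors_eq_zero_iff ha).1 h0)
  regular x hx := Finsupp.ext fun i ↦
    (mul_left_mem_nonZeroDivisors_eq_zero_iff ha).1 (DFunLike.congr_fun hx i)
  smul_eq_zero y := quotient_smul_eq_zero y

/-- A reduction between free covers restricts to a reduction between the first syzygies. -/
lemma ker_map {R' : Type u} [CommRing R'] [Algebra R R'] [Module R' N'] [IsScalarTower R R' N']
    (hp : IsRegularReduction a p)
    {P P' : Type u} [AddCommGroup P] [Module R P] [AddCommGroup P'] [Module R P']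
    [Module R' P'] [IsScalarTower R R' P'] {π : P →ₗ[R] P'} (hπ : IsRegularReduction a π)
    {q : P →ₗ[R] N} (hq : Function.Surjective q) {q' : P' →ₗ[R'] N'}
    (h : ∀ x, q' (π x) = p (q x)) :
    ∃ p' : q.ker →ₗ[R] q'.ker, IsRegularReduction a p' ∧ ∀ x, (p' x : P') = π x := by
  refine ⟨⟨⟨fun x ↦ ⟨π x, by rw [LinearMap.mem_ker, h, x.2, map_zero]⟩, fun x y ↦
    Subtype.ext (map_add π _ _)⟩, fun r x ↦ Subtype.ext (map_smul π _ _)⟩, ⟨?_, ?_, ?_, ?_⟩,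
    fun x ↦ rfl⟩
  · rintro ⟨y, hy⟩
    obtain ⟨x, rfl⟩ := hπ.surjective y
    -- The lift x of y satisfies only q x ∈ aN; subtracting a • w corrects this without changing π
    -- x.
    obtain ⟨z, hz⟩ := hp.exists_smul_eq (q x) (by rw [← h]; exact hy)
    obtain ⟨w, rfl⟩ := hq z
    refine ⟨⟨x - a • w, by rw [LinearMap.mem_ker, map_sub, map_smul, hz, sub_self]⟩,
      Subtype.ext ?_⟩
    change π (x - a • w) = π x
    rw [map_sub, map_smul, hπ.smul_eq_zero, sub_zero]
  · rintro ⟨x, hx⟩ h0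
    obtain ⟨y, rfl⟩ := hπ.exists_smul_eq x (congrArg Subtype.val h0)
    -- Regularity of a on N puts y in the syzygy.
    exact ⟨⟨y, hp.regular _ (by rw [← map_smul]; exact hx)⟩, rfl⟩
  · rintro ⟨x, hx⟩ h0
    exact Subtype.ext (hπ.regular x (congrArg Subtype.val h0))
  · exact fun y ↦ Subtype.ext (hπ.smul_eq_zero _)

lemma quotient (hreg : ∀ x : N, a • x = 0 → x = 0) :
    IsRegularReduction a (Ideal.span {a} • (⊤ : Submodule R N)).mkQ where
  surjective := Submodule.mkQ_surjective _
  exists_smul_eq x hx := by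
    have := (Submodule.Quotient.mk_eq_zero _).1 hx
    rw [Submodule.ideal_span_singleton_smul, Submodule.mem_smul_pointwise_iff_exists] at this
    obtain ⟨y, -, hy⟩ := this
    exact ⟨y, hy⟩
  regular := hreg
  smul_eq_zero y := quotient_smul_eq_zero y

/-- Compatible free covers of a module and of its reduction, with the induced reduction of the
first syzygies. -/
lemma exists_covers (ha : a ∈ nonZeroDivisors R) [Module (R ⧸ Ideal.span {a}) N']
    [IsScalarTower R (R ⧸ Ideal.span {a}) N'] (hp : IsRegularReduction a p) :
    ∃ (q : (N →₀ R) →ₗ[R] N) (q' : (N →₀ R ⧸ Ideal.span {a}) →ₗ[R ⧸ Ideal.span {a}] N')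
      (π : (N →₀ R) →ₗ[R] (N →₀ R ⧸ Ideal.span {a})) (p' : q.ker →ₗ[R] q'.ker),
      Function.Surjective q ∧ Function.Surjective q' ∧ IsRegularReduction a π ∧
        IsRegularReduction (N := q.ker) (N' := q'.ker) a p' ∧ ∀ x, (p' x : N →₀ R ⧸ Ideal.span {a}) = π x := by
  have hπ := finsupp ha N
  let q : (N →₀ R) →ₗ[R] N := Finsupp.linearCombination R id
  let q' : (N →₀ R ⧸ Ideal.span {a}) →ₗ[R ⧸ Ideal.span {a}] N' := Finsupp.linearCombination _ p
  have hq : Function.Surjective q := Finsupp.linearCombination_id_surjective R N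
  have h (x) : q' (Finsupp.mapRange.linearMap (Algebra.linearMap R _) x) = p (q x) := by
    induction x using Finsupp.induction_linear with
    | zero => simp
    | add x y hx hy => simp only [map_add, hx, hy]
    | single i r =>
      simp only [q, q', Finsupp.mapRange.linearMap_apply, Finsupp.mapRange_single,
        Finsupp.linearCombination_single, Algebra.linearMap_apply, algebraMap_smul, map_smul, id]
  have hq' : Function.Surjective q' := fun y ↦ by
    obtain ⟨x, rfl⟩ := hp.surjective y
    obtain ⟨z, rfl⟩ := hq x
    exact ⟨_, h z⟩
  obtain ⟨p', hp', hpp'⟩ := ker_map hp hπ hq h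
  exact ⟨q, q', _, p', hq, hq', hπ, hp', hpp'⟩

/-- Change of rings: `Ext_R^{k+1}(N, X)` agrees with `Ext_{R/a}^{k+1}(N/aN, X)` if `a X = 0` and
`a` is regular on `R` and `N`. -/
lemma extTorsion_iff (ha : a ∈ nonZeroDivisors R) [Module (R ⧸ Ideal.span {a}) N']
    [IsScalarTower R (R ⧸ Ideal.span {a}) N'] (hp : IsRegularReduction a p) (X : Type u)
    [AddCommGroup X] [Module R X] [Module (R ⧸ Ideal.span {a}) X]
    [IsScalarTower R (R ⧸ Ideal.span {a}) X] (k : ℕ) :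
    ExtTorsion S (k + 1) N X ↔
      ExtTorsion (S.map (Ideal.Quotient.mk (Ideal.span {a}))) (k + 1) N' X := by
  have mk_smul (r : R) (x : X) : Ideal.Quotient.mk (Ideal.span {a}) r • x = r • x :=
    algebraMap_smul _ r x
  obtain ⟨q, q', π, p', hq, hq', hπ, hp', hpp'⟩ := hp.exists_covers ha
  induction k generalizing N N' with
  | zero =>
    -- Both Ext¹ are cokernels of Hom(cover, X) → Hom(syzygy, X), and since aX = 0 these Homs agree
    -- over R and R/a.
    rw [zero_add, ExtTorsion.one_iff_ker hq, ExtTorsion.one_iff_ker hq']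
    constructor
    · rintro ⟨s, hs, H⟩
      refine ⟨_, Submonoid.mem_map_of_mem _ hs, fun φ ↦ ?_⟩
      obtain ⟨ψ, hψ⟩ := H ((φ.restrictScalars R).comp p')
      obtain ⟨j, hj⟩ := hπ.exists_factor ψ
      refine ⟨j, LinearMap.ext fun y ↦ ?_⟩
      obtain ⟨x, rfl⟩ := hp'.surjective y
      rw [LinearMap.comp_apply, Submodule.subtype_apply, hpp', hj, LinearMap.smul_apply, mk_smul]
      exact LinearMap.congr_fun hψ x
    · rintro ⟨_, ⟨s, hs, rfl⟩, H⟩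
      refine ⟨s, hs, fun φ ↦ ?_⟩
      obtain ⟨j, hj⟩ := hp'.exists_factor φ
      obtain ⟨ψ, hψ⟩ := H j
      refine ⟨(ψ.restrictScalars R).comp π, LinearMap.ext fun x ↦ ?_⟩
      have := LinearMap.congr_fun hψ (p' x)
      rw [LinearMap.comp_apply, Submodule.subtype_apply, hpp', LinearMap.smul_apply, hj] at this
      exact this.trans (mk_smul _ _)
  | succ k ih =>
    obtain ⟨q₁, q₁', π₁, p₁, h⟩ := hp'.exists_covers ha
    exact (ExtTorsion.succ_iff_ker hq k).trans
      ((ih hp' q₁ q₁' π₁ p₁ h.1 h.2.1 h.2.2.1 h.2.2.2.1 h.2.2.2.2).trans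
        (ExtTorsion.succ_iff_ker hq' k).symm)

end IsRegularReduction

lemma eq_zero_of_smul_eq_zero_of_free (ha : a ∈ nonZeroDivisors R) {P : Type u} [AddCommGroup P]
    [Module R P] [Module.Free R P] (x : P) (hx : a • x = 0) : x = 0 := by
  refine (Module.Free.chooseBasis R P).ext_elem fun i ↦ ?_
  have := congrArg (fun y ↦ (Module.Free.chooseBasis R P).repr y i) hx
  simp only [map_smul, Finsupp.smul_apply, smul_eq_mul, map_zero, Finsupp.zero_apply] at this ⊢
  exact (mul_left_mem_nonZeroDivisors_eq_zero_iff ha).1 this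

lemma IsRegularReduction.of_ker (ha : a ∈ nonZeroDivisors R) {P N : Type u} [AddCommGroup P]
    [Module R P] [Module.Free R P] [AddCommGroup N] [Module R N] (q : P →ₗ[R] N) :
    IsRegularReduction a (Ideal.span {a} • (⊤ : Submodule R q.ker)).mkQ :=
  .quotient fun _ hx ↦ Subtype.ext
    (eq_zero_of_smul_eq_zero_of_free ha _ (congrArg Subtype.val hx))

section

variable {M : Type u} [AddCommGroup M] [Module R M]
  [Module (R ⧸ Ideal.span {a}) M] [IsScalarTower R (R ⧸ Ideal.span {a}) M] {n : ℕ}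

/-- With K the first syzygy of N, shift Ext_R^{n+2}(N, M⋆) to Ext_R^{n+1}(K, M⋆) and reduce K modulo
a. -/
lemma TorTorsionAbove.of_quotient (ha : a ∈ nonZeroDivisors R)
    (h : TorTorsionAbove (S.map (Ideal.Quotient.mk (Ideal.span {a}))) n M) :
    TorTorsionAbove S (n + 1) M := by
  intro N _ _
  obtain ⟨P, _, _, q, _, hq⟩ := exists_free_cover R N
  rw [ExtTorsion.succ_iff_ker hq,
    (IsRegularReduction.of_ker ha q).extTorsion_iff ha]
  exact h _

/-- In 0 → Y → K/aK → C → 0, `h` controls Ext^{n+1} of K/aK and `h'` controls Ext^{n+2} of C. -/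
lemma TorTorsionAbove.quotient (ha : a ∈ nonZeroDivisors R) (h : TorTorsionAbove S (n + 1) M)
    (h' : TorTorsionAbove (S.map (Ideal.Quotient.mk (Ideal.span {a}))) (n + 1) M) :
    TorTorsionAbove (S.map (Ideal.Quotient.mk (Ideal.span {a}))) n M := by
  intro Y _ _
  let _ : Module R Y := Module.compHom Y (Ideal.Quotient.mk (Ideal.span {a}))
  have : IsScalarTower R (R ⧸ Ideal.span {a}) Y := .of_algebraMap_smul fun _ _ ↦ rfl
  obtain ⟨P, _, _, q, _, hq⟩ := exists_free_cover R Y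
  have hr := IsRegularReduction.of_ker ha q
  have hK := (hr.extTorsion_iff ha _ n).1 ((ExtTorsion.succ_iff_ker hq n).1 (h Y))
  -- `Y` embeds in `K ⧸ a K`, `K` the kernel of the free cover, via multiplication by `a`
  let f : P →ₗ[R] q.ker := (LinearMap.lsmul R P a).codRestrict q.ker fun x ↦ by
    rw [LinearMap.mem_ker, LinearMap.lsmul_apply, map_smul, quotient_smul_eq_zero]
  obtain ⟨j, hj⟩ := exists_quotient_linearMap (I := Ideal.span {a}) q hq
    ((Ideal.span {a} • (⊤ : Submodule R q.ker)).mkQ.comp f) fun x hx ↦ by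
      have : f x = a • ⟨x, hx⟩ := rfl
      rw [LinearMap.mem_ker, LinearMap.comp_apply, this, map_smul, hr.smul_eq_zero]
  have hinj : Function.Injective j := by
    rw [injective_iff_map_eq_zero]
    intro y hy
    obtain ⟨x, rfl⟩ := hq y
    rw [hj] at hy
    obtain ⟨z, hz⟩ := hr.exists_smul_eq _ hy
    have : x - z = 0 := eq_zero_of_smul_eq_zero_of_free ha _ (by
      rw [smul_sub, sub_eq_zero]
      exact (congrArg Subtype.val hz).symm)
    rw [sub_eq_zero.1 this]
    exact z.2
  exact ExtTorsion.contra_left hinj (g := j.range.mkQ)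
    (LinearMap.exact_iff.2 (by rw [Submodule.ker_mkQ])) (Submodule.mkQ_surjective _) hK (h' _)

end

end ChangeOfRings

/-! ### The two parts of the proposition -/

section Main

variable {R : Type u} [CommRing R] {S : Submonoid R} {a : R} {M : Type u} [AddCommGroup M]
  [Module R M] [Module (R ⧸ Ideal.span {a}) M] [IsScalarTower R (R ⧸ Ideal.span {a}) M]

/-- Tensoring the injection a : R → R with M gives zero on M, so its kernel is all of M. -/
lemma isUniformlySTorsion_of_isSFlat (ha : a ∈ nonZeroDivisors R) (h : IsSFlat S M) :
    IsUniformlySTorsion (S.map (Ideal.Quotient.mk (Ideal.span {a}))) M := by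
  obtain ⟨s, hs, H⟩ := (isSFlat_iff_injective M).1 h R R (LinearMap.lsmul R R a) fun x y hxy ↦
    (mul_cancel_left_mem_nonZeroDivisors ha).1 hxy
  refine ⟨_, Submonoid.mem_map_of_mem _ hs, fun x ↦ ?_⟩
  have h0 := congrArg (TensorProduct.lid R M) (H (1 ⊗ₜ x) (by
    rw [LinearMap.rTensor_tmul, LinearMap.lsmul_apply, TensorProduct.smul_tmul,
      quotient_smul_eq_zero, TensorProduct.tmul_zero]))
  rw [map_smul, TensorProduct.lid_tmul, one_smul, map_zero] at h0
  exact (algebraMap_smul (R ⧸ Ideal.span {a}) s x).trans h0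

theorem sFlatDim_eq_sFlatDim_quotient_add_one (ha : a ∈ nonZeroDivisors R)
    (hM : ¬ IsUniformlySTorsion (S.map (Ideal.Quotient.mk (Ideal.span {a}))) M)
    (h : sFlatDim (S.map (Ideal.Quotient.mk (Ideal.span {a}))) M < ⊤) :
    sFlatDim S M = sFlatDim (S.map (Ideal.Quotient.mk (Ideal.span {a}))) M + 1 := by
  obtain ⟨n, hn⟩ := ENat.ne_top_iff_exists.1 h.ne
  have hD := sFlatDim_le_iff.1 hn.ge
  have hle : sFlatDim S M ≤ (n + 1 : ℕ) := sFlatDim_le_iff.2 (hD.of_quotient ha)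
  rw [← hn]
  refine le_antisymm (by exact_mod_cast hle) (Order.add_one_le_of_lt (lt_of_not_ge fun hlt ↦ ?_))
  have hR := sFlatDim_le_iff.1 hlt
  cases n with
  | zero =>
    exact hM (isUniformlySTorsion_of_isSFlat ha ((isSFlat_iff_torTorsionAbove M).2 hR))
  | succ n =>
    have := sFlatDim_le_iff.2 (hR.quotient ha hD)
    rw [← hn, Nat.cast_le] at this
    lia

theorem sWeakGlobalDim_quotient_add_one_le (ha : a ∈ nonZeroDivisors R)
    (hS : 0 ∉ S.map (Ideal.Quotient.mk (Ideal.span {a})))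
    (h : sWeakGlobalDim (R ⧸ Ideal.span {a}) (S.map (Ideal.Quotient.mk (Ideal.span {a}))) < ⊤) :
    sWeakGlobalDim (R ⧸ Ideal.span {a}) (S.map (Ideal.Quotient.mk (Ideal.span {a}))) + 1 ≤
      sWeakGlobalDim R S := by
  obtain ⟨n, hn⟩ := ENat.ne_top_iff_exists.1 h.ne
  have hle (M : ModuleCat.{u} (R ⧸ Ideal.span {a})) :
      sFlatDim (S.map (Ideal.Quotient.mk (Ideal.span {a}))) M ≤ n := by
    rw [hn]
    exact le_iSup (fun M : ModuleCat.{u} (R ⧸ Ideal.span {a}) ↦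
      sFlatDim (S.map (Ideal.Quotient.mk (Ideal.span {a}))) M) M
  -- the supremum is attained at a module that is not uniformly torsion
  obtain ⟨M, hM, hMn⟩ : ∃ M : ModuleCat.{u} (R ⧸ Ideal.span {a}),
      ¬ IsUniformlySTorsion (S.map (Ideal.Quotient.mk (Ideal.span {a}))) M ∧
        n ≤ sFlatDim (S.map (Ideal.Quotient.mk (Ideal.span {a}))) M := by
    cases n with
    | zero =>
      refine ⟨ModuleCat.of _ (R ⧸ Ideal.span {a}), fun ⟨s, hs, H⟩ ↦ hS ?_, by simp⟩
      have : s * 1 = 0 := H 1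
      rwa [← this, mul_one]
    | succ n =>
      obtain ⟨M, hM⟩ := lt_iSup_iff.1 (show (n : ℕ∞) < ⨆ M : ModuleCat.{u} (R ⧸ Ideal.span {a}),
        sFlatDim (S.map (Ideal.Quotient.mk (Ideal.span {a}))) M by
          rw [← sWeakGlobalDim, ← hn, Nat.cast_lt]; exact n.lt_succ_self)
      refine ⟨M, fun hT ↦ not_lt_of_ge ?_ hM, by
        rw [Nat.cast_succ]; exact Order.add_one_le_of_lt hM⟩
      -- A torsion module has dimension at most every n, so it cannot exceed n.
      exact sFlatDim_le_iff.2 (.of_isUniformlySTorsion hT n)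
  let _ : Module R M := Module.compHom M (Ideal.Quotient.mk (Ideal.span {a}))
  have : IsScalarTower R (R ⧸ Ideal.span {a}) M := .of_algebraMap_smul fun _ _ ↦ rfl
  have key := sFlatDim_eq_sFlatDim_quotient_add_one ha hM
    ((hle M).trans_lt (ENat.natCast_lt_top n))
  rw [le_antisymm (hle M) hMn] at key
  rw [← hn, ← key]
  exact le_iSup (fun M : ModuleCat.{u} R ↦ sFlatDim S M) (ModuleCat.of R M)

end Main

theorem mainTheorem7 {R : Type u} [CommRing R] (S : Submonoid R) (a : R)
    (ha : a ∈ nonZeroDivisors R) (hu : ¬ IsUnit a) :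
    (∀ (M : Type u) [AddCommGroup M] [Module R M] [Module (R ⧸ Ideal.span {a}) M]
        [IsScalarTower R (R ⧸ Ideal.span {a}) M],
      ¬ IsUniformlySTorsion (S.map (Ideal.Quotient.mk (Ideal.span {a}))) M →
      sFlatDim (S.map (Ideal.Quotient.mk (Ideal.span {a}))) M < ⊤ →
      sFlatDim S M = sFlatDim (S.map (Ideal.Quotient.mk (Ideal.span {a}))) M + 1) ∧
    (0 ∉ S.map (Ideal.Quotient.mk (Ideal.span {a})) →
      sWeakGlobalDim (R ⧸ Ideal.span {a}) (S.map (Ideal.Quotient.mk (Ideal.span {a}))) < ⊤ →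
      sWeakGlobalDim R S ≥
        sWeakGlobalDim (R ⧸ Ideal.span {a}) (S.map (Ideal.Quotient.mk (Ideal.span {a}))) + 1) :=
  ⟨fun _ _ _ _ _ hM h ↦ sFlatDim_eq_sFlatDim_quotient_add_one ha hM h,
    fun hS h ↦ sWeakGlobalDim_quotient_add_one_le ha hS h⟩
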